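/- Let $\Phi$ be a unital commutative ring containing $\frac12$, and let $X=X^+\cup X^-$ be a disjoint union of two sets. A Lie algebra $L$ over $\Phi$ is 3-graded if $L=L_1\oplus L_0\oplus L_{-1}$ with $[L_i,L_j]\subseteq L_{i+j}$, where $L_{i+j}=0$ for $i+j\notin\{0,\pm1\}$. Let $\mathcal L(X^+,X^-)$ be the free 3-graded Lie algebra on $X$: the quotient of the free Lie algebra on $X$ by the ideal generated by all monomials $[x_1,[x_2,[x_3,\ldots,x_{2n}]\ldots]]$ with $n\ge1$, $x_i\in X^{\sigma_i}$, $\sigma_1=\sigma_2$ and $\sigma_{2i-1}+\sigma_{2i}=0$ for $2\le i\le n$. An element $f\in\mathcal L(X^+,X^-)$ is called a 3-graded polynomial; it is an identity of a 3-graded Lie algebra $L$ if it is sent to $0$ by every Lie homomorphism $\mathcal L(X^+,X^-)\to L$ that maps $X^+$ into $L_1$ and $X^-$ into $L_{-1}$. Let $Ass[X^+,X^-]$ be the free associative $\Phi$-algebra on $X$ modulo the relations $xy=0$ for $x,y\in X^+$ and for $x,y\in X^-$; it has as a $\Phi$-basis the words in which elements of $X^+$ and $X^-$ alternate. Let $S\mathcal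 L(X^+,X^-)$ be the Lie subalgebra of $Ass[X^+,X^-]$ (with the commutator bracket) generated by $X$, and let $\pi:\mathcal L(X^+,X^-)\to S\mathcal L(X^+,X^-)$ be the Lie homomorphism extending the inclusion of $X$. Call $f$ essential if $\pi(f)\neq0$ and, among the words of maximal length occurring in $\pi(f)$, at least one has coefficient $1$. For $p,q\in\mathbb N$ let $sl(p+q)$ be the Lie algebra of trace zero $(p+q)\times(p+q)$ matrices over $\Phi$, 3-graded by blocks: $sl(p+q)_1$ consists of the matrices supported in the upper right $p\times q$ block, $sl(p+q)_{-1}$ of those supported in the lower left $q\times p$ block, and $sl(p+q)_0$ of the block diagonal matrices of trace zero. Proposition. Let $f\in\mathcal L(X^+,X^-)$. Then $\pi(f)\neq0$ if and only if there exist $p,q\in\mathbb N$ such that $f$ is not an identity of $sl(p+q)$. Consequently, if $\Phi$ is a field, then some nonzero scalar multiple $cf$ ($c\in\Phi$, $c\ne0$) of $f$ is essential if and only if there exist $p,q\in\mathbb N$ such that $f$ is not an identity of $sl(p+q)$. -/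

import Mathlib

noncomputable section

namespace ThreeGraded

universe u v w

/-! ### Free 3-graded Lie algebras -/

section FreeLie

variable {Xp : Type v} {Xm : Type w}

/-- The sign (degree) of an element of the polarized set `X = X⁺ ∪ X⁻`, the disjoint union of
`Xp` and `Xm`: it is `1` on `X⁺` and `-1` on `X⁻`. -/
def sgn : Xp ⊕ Xm → ℤ := Sum.elim (fun _ => 1) (fun _ => -1)

/-- Words `x₁ x₂ x₃ x₄ … x₂ₙ₋₁ x₂ₙ` of even length with
`sgn x₂ᵢ₋₁ + sgn x₂ᵢ = 0` for all `i`. -/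
inductive IsPaired : List (Xp ⊕ Xm) → Prop
  | nil : IsPaired []
  | cons {x y : Xp ⊕ Xm} {l : List (Xp ⊕ Xm)} :
      sgn x + sgn y = 0 → IsPaired l → IsPaired (x :: y :: l)

/-- The right-normed bracket `[a₁,[a₂,[…,aₙ]…]]` of a nonempty list (and `0` for `[]`). -/
def rightNormed {L : Type*} [LieRing L] : List L → L
  | [] => 0
  | [a] => a
  | a :: b :: l => ⁅a, rightNormed (b :: l)⁆

variable (Φ : Type u) [CommRing Φ] (Xp : Type v) (Xm : Type w)

/-- The monomials `[x₁,[x₂,[x₃,…,x₂ₙ]…]]`, `n ≥ 1`, of the free Lie algebra on `X⁺ ∪ X⁻` with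
`σ₁ = σ₂` and `σ₂ᵢ₋₁ + σ₂ᵢ = 0` for `i ≥ 2`, where `σᵢ` is the sign of `xᵢ`. -/
def relators : Set (FreeLieAlgebra Φ (Xp ⊕ Xm)) :=
  {m | ∃ (x y : Xp ⊕ Xm) (l : List (Xp ⊕ Xm)), sgn x = sgn y ∧ IsPaired l ∧
    m = rightNormed ((x :: y :: l).map (FreeLieAlgebra.of Φ))}

/-- The ideal of the free Lie algebra generated by `relators`. -/
def relatorIdeal : LieIdeal Φ (FreeLieAlgebra Φ (Xp ⊕ Xm)) :=
  LieSubmodule.lieSpan Φ (FreeLieAlgebra Φ (Xp ⊕ Xm)) (relators Φ Xp Xm)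

/-- The free 3-graded Lie algebra `𝓛(X⁺, X⁻)` over `Φ`. Its elements are the
3-graded (Lie) polynomials. -/
abbrev FreeThreeGradedLie : Type _ :=
  FreeLieAlgebra Φ (Xp ⊕ Xm) ⧸ relatorIdeal Φ Xp Xm

variable {Φ Xp Xm} {L : Type*} [LieRing L] [LieAlgebra Φ L]

theorem map_rightNormed {L' : Type*} [LieRing L'] [LieAlgebra Φ L'] (F : L' →ₗ⁅Φ⁆ L) :
    ∀ l : List L', F (rightNormed l) = rightNormed (l.map F)
  | [] => by simp [rightNormed]
  | [a] => by simp [rightNormed]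
  | a :: b :: l => by
      have := map_rightNormed F (b :: l)
      simp only [rightNormed, List.map_cons, LieHom.map_lie] at this ⊢
      rw [this]

theorem relatorIdeal_le_ker (g : Xp ⊕ Xm → L)
    (hg : ∀ (x y : Xp ⊕ Xm) (l : List (Xp ⊕ Xm)), sgn x = sgn y → IsPaired l →
      rightNormed ((x :: y :: l).map g) = 0) :
    relatorIdeal Φ Xp Xm ≤ (FreeLieAlgebra.lift Φ g).ker := by
  refine LieSubmodule.lieSpan_le.2 ?_
  rintro m ⟨x, y, l, hxy, hl, rfl⟩
  change FreeLieAlgebra.lift Φ g _ = 0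
  rw [map_rightNormed, List.map_map, FreeLieAlgebra.of_comp_lift]
  exact hg x y l hxy hl

/-- A map `g` from `X⁺ ∪ X⁻` to a Lie algebra in which the defining monomials of `𝓛(X⁺, X⁻)` vanish
extends to a homomorphism on `𝓛(X⁺, X⁻)`. -/
def liftOfRelators (g : Xp ⊕ Xm → L)
    (hg : ∀ (x y : Xp ⊕ Xm) (l : List (Xp ⊕ Xm)), sgn x = sgn y → IsPaired l →
      rightNormed ((x :: y :: l).map g) = 0) :
    FreeThreeGradedLie Φ Xp Xm →ₗ⁅Φ⁆ L :=
  { (relatorIdeal Φ Xp Xm).toSubmodule.liftQ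
      (FreeLieAlgebra.lift Φ g : FreeLieAlgebra Φ (Xp ⊕ Xm) →ₗ[Φ] L)
      (fun _ hm => relatorIdeal_le_ker g hg hm) with
    map_lie' := by
      intro x y
      induction x using Submodule.Quotient.induction_on with | _ x =>
      induction y using Submodule.Quotient.induction_on with | _ y =>
      exact LieHom.map_lie (FreeLieAlgebra.lift Φ g) x y }

theorem liftOfRelators_mk (g : Xp ⊕ Xm → L)
    (hg : ∀ (x y : Xp ⊕ Xm) (l : List (Xp ⊕ Xm)), sgn x = sgn y → IsPaired l →
      rightNormed ((x :: y :: l).map g) = 0) (m : FreeLieAlgebra Φ (Xp ⊕ Xm)) :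
    liftOfRelators (Φ := Φ) g hg (LieSubmodule.Quotient.mk m) = FreeLieAlgebra.lift Φ g m :=
  rfl

end FreeLie

/-! ### 3-graded Lie algebras and their identities -/

/-- A 3-grading `L = L₁ ⊕ L₀ ⊕ L₋₁` of a Lie algebra: `[Lᵢ, Lⱼ] ⊆ Lᵢ₊ⱼ`, with `Lᵢ₊ⱼ = 0` for
`i + j ∉ {0, 1, -1}`. -/
structure ThreeGrading (Φ : Type*) [CommRing Φ] (L : Type*) [LieRing L] [LieAlgebra Φ L] where
  /-- the component `L₁` -/
  pos : Submodule Φ L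
  /-- the component `L₀` -/
  zero : Submodule Φ L
  /-- the component `L₋₁` -/
  neg : Submodule Φ L
  /-- `L` is the direct sum of the three components -/
  existsUnique_add : ∀ x : L, ∃! t : pos × zero × neg, (t.1 : L) + t.2.1 + t.2.2 = x
  lie_pos_pos : ∀ x ∈ pos, ∀ y ∈ pos, ⁅x, y⁆ = 0
  lie_neg_neg : ∀ x ∈ neg, ∀ y ∈ neg, ⁅x, y⁆ = 0
  lie_pos_neg : ∀ x ∈ pos, ∀ y ∈ neg, ⁅x, y⁆ ∈ zero
  lie_zero_pos : ∀ x ∈ zero, ∀ y ∈ pos, ⁅x, y⁆ ∈ pos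
  lie_zero_neg : ∀ x ∈ zero, ∀ y ∈ neg, ⁅x, y⁆ ∈ neg
  lie_zero_zero : ∀ x ∈ zero, ∀ y ∈ zero, ⁅x, y⁆ ∈ zero

namespace ThreeGrading

variable {Φ : Type*} [CommRing Φ] {L : Type*} [LieRing L] [LieAlgebra Φ L]
  {Xp : Type*} {Xm : Type*} (G : ThreeGrading Φ L)

/-- The map `X⁺ ∪ X⁻ → L` given by `a : X⁺ → L₁` and `b : X⁻ → L₋₁`. -/
def assignment (a : Xp → G.pos) (b : Xm → G.neg) : Xp ⊕ Xm → L :=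
  Sum.elim (fun x => (a x : L)) (fun y => (b y : L))

theorem lie_neg_zero_mem {x y : L} (hx : x ∈ G.neg) (hy : y ∈ G.zero) : ⁅x, y⁆ ∈ G.neg := by
  rw [← lie_skew]; exact G.neg.neg_mem (G.lie_zero_neg y hy x hx)

theorem lie_pos_zero_mem {x y : L} (hx : x ∈ G.pos) (hy : y ∈ G.zero) : ⁅x, y⁆ ∈ G.pos := by
  rw [← lie_skew]; exact G.pos.neg_mem (G.lie_zero_pos y hy x hx)

theorem lie_neg_pos_mem {x y : L} (hx : x ∈ G.neg) (hy : y ∈ G.pos) : ⁅x, y⁆ ∈ G.zero := by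
  rw [← lie_skew]; exact G.zero.neg_mem (G.lie_pos_neg y hy x hx)

theorem rightNormed_cons_mem (a : Xp → G.pos) (b : Xm → G.neg) {l : List (Xp ⊕ Xm)}
    (hl : IsPaired l) :
    rightNormed (l.map (G.assignment a b)) ∈ G.zero ∧
    (∀ x, rightNormed ((Sum.inl x :: l).map (G.assignment a b)) ∈ G.pos) ∧
    (∀ y, rightNormed ((Sum.inr y :: l).map (G.assignment a b)) ∈ G.neg) := by
  have key : ∀ l : List (Xp ⊕ Xm), l ≠ [] → rightNormed (l.map (G.assignment a b)) ∈ G.zero →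
      (∀ x, rightNormed ((Sum.inl x :: l).map (G.assignment a b)) ∈ G.pos) ∧
      (∀ y, rightNormed ((Sum.inr y :: l).map (G.assignment a b)) ∈ G.neg) := by
    intro l hne h0
    obtain ⟨c, l, rfl⟩ := List.exists_cons_of_ne_nil hne
    exact ⟨fun x => G.lie_pos_zero_mem (a x).2 h0, fun y => G.lie_neg_zero_mem (b y).2 h0⟩
  induction hl with
  | nil =>
    exact ⟨G.zero.zero_mem, fun x => (a x).2, fun y => (b y).2⟩
  | @cons x y l hxy _ ih =>
    have h0 : rightNormed ((x :: y :: l).map (G.assignment a b)) ∈ G.zero := by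
      rcases x with x | x <;> rcases y with y | y
      · simp [sgn] at hxy
      · exact G.lie_pos_neg _ (a x).2 _ (ih.2.2 y)
      · exact G.lie_neg_pos_mem (b x).2 (ih.2.1 y)
      · simp [sgn] at hxy
    exact ⟨h0, key _ (by simp) h0⟩

theorem relators_vanish (a : Xp → G.pos) (b : Xm → G.neg)
    (x y : Xp ⊕ Xm) (l : List (Xp ⊕ Xm)) (hxy : sgn x = sgn y) (hl : IsPaired l) :
    rightNormed ((x :: y :: l).map (G.assignment a b)) = 0 := by
  have h := G.rightNormed_cons_mem a b hl
  rcases x with x | x <;> rcases y with y | y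
  · exact G.lie_pos_pos _ (a x).2 _ (h.2.1 y)
  · simp [sgn] at hxy
  · simp [sgn] at hxy
  · exact G.lie_neg_neg _ (b x).2 _ (h.2.2 y)

/-- The homomorphism `𝓛(X⁺, X⁻) → L` extending given maps `a : X⁺ → L₁` and
`b : X⁻ → L₋₁`. -/
def eval (a : Xp → G.pos) (b : Xm → G.neg) : FreeThreeGradedLie Φ Xp Xm →ₗ⁅Φ⁆ L :=
  liftOfRelators (G.assignment a b) (G.relators_vanish a b)

/-- `f ∈ 𝓛(X⁺, X⁻)` is a 3-graded polynomial identity of the 3-graded Lie algebra `L` if it is mapped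
to zero by every homomorphism extending a map `φ : X → L` with `φ(X⁺) ⊆ L₁` and `φ(X⁻) ⊆ L₋₁`. -/
def IsIdentity (f : FreeThreeGradedLie Φ Xp Xm) : Prop :=
  ∀ (a : Xp → G.pos) (b : Xm → G.neg), G.eval a b f = 0

end ThreeGrading

/-! ### The free special 3-graded Lie algebra -/

section Special

attribute [local instance] LieRing.ofAssociativeRing

variable (Φ : Type u) [CommRing Φ] (Xp : Type v) (Xm : Type w)

/-- The relations `x y = 0` for `x, y` both in `X⁺` or both in `X⁻`. -/
inductive AssRel : FreeAlgebra Φ (Xp ⊕ Xm) → FreeAlgebra Φ (Xp ⊕ Xm) → Prop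
  | mul {x y : Xp ⊕ Xm} : sgn x = sgn y → AssRel (FreeAlgebra.ι Φ x * FreeAlgebra.ι Φ y) 0

/-- The free 3-graded associative algebra `Ass[X⁺, X⁻]`. -/
abbrev FreeThreeGradedAss : Type _ := RingQuot (AssRel Φ Xp Xm)

/-- The quotient map `Ass[X] → Ass[X⁺, X⁻]` from the free associative algebra. -/
def assMk : FreeAlgebra Φ (Xp ⊕ Xm) →ₐ[Φ] FreeThreeGradedAss Φ Xp Xm :=
  RingQuot.mkAlgHom Φ (AssRel Φ Xp Xm)

variable {Xp Xm} in
/-- The image of a generator in `Ass[X⁺, X⁻]`. -/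
def assGen (x : Xp ⊕ Xm) : FreeThreeGradedAss Φ Xp Xm := assMk Φ Xp Xm (FreeAlgebra.ι Φ x)

/-- The free special 3-graded Lie algebra `S𝓛(X⁺, X⁻)`: the Lie subalgebra of `Ass[X⁺, X⁻]`, with
the commutator bracket, generated by `X`. -/
def SpecialLie : LieSubalgebra Φ (FreeThreeGradedAss Φ Xp Xm) :=
  LieSubalgebra.lieSpan Φ (FreeThreeGradedAss Φ Xp Xm) (Set.range (assGen Φ))

variable {Xp Xm} in
/-- A generator as an element of `S𝓛(X⁺, X⁻)`. -/
def specialGen (x : Xp ⊕ Xm) : SpecialLie Φ Xp Xm :=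
  ⟨assGen Φ x, LieSubalgebra.subset_lieSpan (Set.mem_range_self x)⟩

variable {Xp Xm}

theorem assGen_mul_assGen {x y : Xp ⊕ Xm} (h : sgn x = sgn y) : assGen Φ x * assGen Φ y = 0 := by
  have := RingQuot.mkAlgHom_rel Φ (AssRel.mul (Φ := Φ) h)
  simpa [assGen, assMk] using this

theorem sgn_eq_or {x y : Xp ⊕ Xm} (z : Xp ⊕ Xm) (h : sgn x + sgn y = 0) :
    (sgn z = sgn x) ∨ (sgn z = sgn y) := by
  rcases x with x | x <;> rcases y with y | y <;> rcases z with z | z <;> simp [sgn] at h ⊢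

theorem assGen_paired {l : List (Xp ⊕ Xm)} (hl : IsPaired l) :
    ∀ x y : Xp ⊕ Xm, sgn x = sgn y →
      assGen Φ x * rightNormed (l.map (assGen Φ)) * assGen Φ y = 0 := by
  induction hl with
  | nil => intro x y _; simp [rightNormed]
  | @cons c d l hcd _ ih =>
    intro x y hxy
    rcases l with _ | ⟨e, l⟩
    · simp only [List.map_cons, List.map_nil, rightNormed, Ring.lie_def]
      rcases sgn_eq_or x hcd with h | h
      · have h1 := assGen_mul_assGen Φ h
        have h2 := assGen_mul_assGen Φ (h.symm.trans hxy)
        simp only [mul_sub, sub_mul, mul_assoc, h2, mul_zero, sub_zero]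
        simp [← mul_assoc, h1]
      · have h1 := assGen_mul_assGen Φ h
        have h2 := assGen_mul_assGen Φ (h.symm.trans hxy)
        simp only [mul_sub, sub_mul, mul_assoc, h2, mul_zero, zero_sub]
        simp [← mul_assoc, h1]
    · have e1 : rightNormed ((c :: d :: e :: l).map (assGen Φ)) =
          ⁅assGen Φ c, ⁅assGen Φ d, rightNormed ((e :: l).map (assGen Φ))⁆⁆ := rfl
      rw [e1]
      generalize rightNormed ((e :: l).map (assGen Φ)) = u at ih
      simp only [Ring.lie_def]
      have expand : assGen Φ x * (assGen Φ c * (assGen Φ d * u - u * assGen Φ d) -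
            (assGen Φ d * u - u * assGen Φ d) * assGen Φ c) * assGen Φ y =
          (assGen Φ x * assGen Φ c) * assGen Φ d * u * assGen Φ y
          - (assGen Φ x * assGen Φ c) * u * assGen Φ d * assGen Φ y
          - assGen Φ x * assGen Φ d * u * (assGen Φ c * assGen Φ y)
          + assGen Φ x * u * assGen Φ d * (assGen Φ c * assGen Φ y) := by
        simp only [mul_sub, sub_mul, mul_assoc]; abel
      rw [expand]
      rcases sgn_eq_or x hcd with h | h
      · have h1 := assGen_mul_assGen Φ h
        have h2 := assGen_mul_assGen Φ (h.symm.trans hxy)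
        simp [h1, h2]
      · have h1 := assGen_mul_assGen Φ h
        have h2 := assGen_mul_assGen Φ (h.symm.trans hxy)
        have i1 := ih d y (h.symm.trans hxy)
        have i2 := ih x d h
        have t1 : assGen Φ x * assGen Φ c * assGen Φ d * u * assGen Φ y = 0 := by
          rw [mul_assoc (_ * _) _ u, mul_assoc (_ * _) _ (assGen Φ y), i1, mul_zero]
        have t2 : assGen Φ x * assGen Φ c * u * assGen Φ d * assGen Φ y = 0 := by
          rw [mul_assoc _ (assGen Φ d) (assGen Φ y), h2, mul_zero]
        rw [t1, t2, i2, h1]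
        simp

theorem special_relators_vanish (x y : Xp ⊕ Xm) (l : List (Xp ⊕ Xm)) (hxy : sgn x = sgn y)
    (hl : IsPaired l) : rightNormed ((x :: y :: l).map (specialGen Φ)) = 0 := by
  apply Subtype.val_injective
  have hmap := map_rightNormed (SpecialLie Φ Xp Xm).incl ((x :: y :: l).map (specialGen Φ))
  rw [List.map_map] at hmap
  have hcomp : (⇑(SpecialLie Φ Xp Xm).incl ∘ specialGen Φ) = assGen Φ := rfl
  rw [hcomp] at hmap
  refine Eq.trans (b := rightNormed ((x :: y :: l).map (assGen Φ))) hmap ?_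
  have xy := assGen_mul_assGen Φ hxy
  have yx := assGen_mul_assGen Φ hxy.symm
  rcases l with _ | ⟨e, l⟩
  · simp [rightNormed, Ring.lie_def, xy, yx]
  · have p1 := assGen_paired Φ hl x y hxy
    have p2 := assGen_paired Φ hl y x hxy.symm
    have e1 : rightNormed ((x :: y :: e :: l).map (assGen Φ)) =
        ⁅assGen Φ x, ⁅assGen Φ y, rightNormed ((e :: l).map (assGen Φ))⁆⁆ := rfl
    rw [e1]
    generalize rightNormed ((e :: l).map (assGen Φ)) = u at p1 p2
    have expand : ⁅assGen Φ x, ⁅assGen Φ y, u⁆⁆ = (assGen Φ x * assGen Φ y) * u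
        - assGen Φ x * u * assGen Φ y - assGen Φ y * u * assGen Φ x
        + u * (assGen Φ y * assGen Φ x) := by
      simp only [Ring.lie_def]; simp only [mul_sub, sub_mul, mul_assoc]; abel
    rw [expand, xy, yx, p1, p2]
    simp

/-- The homomorphism `π : 𝓛(X⁺, X⁻) → S𝓛(X⁺, X⁻)` extending the inclusion `X ⊆ S𝓛(X⁺, X⁻)`. -/
def specialProj : FreeThreeGradedLie Φ Xp Xm →ₗ⁅Φ⁆ SpecialLie Φ Xp Xm :=
  liftOfRelators (specialGen Φ) (special_relators_vanish Φ)

variable {Φ}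

/-- The coefficient of a word in an element of the free associative algebra `Ass[X]`. -/
def wordCoeff (h : FreeAlgebra Φ (Xp ⊕ Xm)) (w : List (Xp ⊕ Xm)) : Φ :=
  (FreeAlgebra.equivMonoidAlgebraFreeMonoid h).coeff (FreeMonoid.ofList w)

/-- An element of `Ass[X⁺, X⁻]` has a unique representative `h ∈ Ass[X]` all of whose monomials are
words with alternating signs (these words form a `Φ`-basis of `Ass[X⁺, X⁻]`). The element has a monic
leading term if among the monomials of highest degree occurring in `h` there is one with
coefficient `1`. -/
def HasMonicLeadingTerm (g : FreeThreeGradedAss Φ Xp Xm) : Prop :=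
  ∃ h : FreeAlgebra Φ (Xp ⊕ Xm), assMk Φ Xp Xm h = g ∧
    (∀ w, wordCoeff h w ≠ 0 → w.IsChain (fun x y => sgn x ≠ sgn y)) ∧
    ∃ w, wordCoeff h w ≠ 0 ∧ wordCoeff h w = 1 ∧
      ∀ w', wordCoeff h w' ≠ 0 → w'.length ≤ w.length

/-- A 3-graded polynomial `f` is essential if `π(f)` is nonzero and has a monic leading term (of
highest degree) as an associative polynomial. -/
def IsEssential (f : FreeThreeGradedLie Φ Xp Xm) : Prop :=
  specialProj Φ f ≠ 0 ∧
    HasMonicLeadingTerm (specialProj Φ f : FreeThreeGradedAss Φ Xp Xm)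

end Special

/-! ### The 3-graded Lie algebras `sl(p + q)` -/

section SL

attribute [local instance] LieRing.ofAssociativeRing

open LieAlgebra.SpecialLinear Matrix

variable (Φ : Type u) [CommRing Φ] (p q : ℕ)

/-- `sl(p + q)` over `Φ`: trace zero matrices, with rows and columns indexed by `p + q` indices
separated into a block of `p` and a block of `q`. -/
abbrev slBlock : LieSubalgebra Φ (Matrix (Fin p ⊕ Fin q) (Fin p ⊕ Fin q) Φ) :=
  sl (Fin p ⊕ Fin q) Φ

/-- The 3-grading of `sl(p + q)` given by the decomposition `n = p + q`: the component of degree `1`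
consists of the matrices supported in the upper right `p × q` block, that of degree `-1` of
those supported in the lower left `q × p` block, and that of degree `0` of the block diagonal matrices
(of trace zero). -/
def slGrading : ThreeGrading Φ (slBlock Φ p q) where
  pos :=
    { carrier := {A | ∃ M : Matrix (Fin p) (Fin q) Φ, A.1 = fromBlocks 0 M 0 0}
      add_mem' := by
        rintro A B ⟨M, hM⟩ ⟨N, hN⟩
        exact ⟨M + N, by simp [hM, hN, fromBlocks_add]⟩
      zero_mem' := ⟨0, by simp⟩
      smul_mem' := by
        rintro c A ⟨M, hM⟩
        exact ⟨c • M, by simp [hM, fromBlocks_smul]⟩ }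
  zero :=
    { carrier := {A | ∃ (M : Matrix (Fin p) (Fin p) Φ) (N : Matrix (Fin q) (Fin q) Φ),
        A.1 = fromBlocks M 0 0 N}
      add_mem' := by
        rintro A B ⟨M, M', hM⟩ ⟨N, N', hN⟩
        exact ⟨M + N, M' + N', by simp [hM, hN, fromBlocks_add]⟩
      zero_mem' := ⟨0, 0, by simp⟩
      smul_mem' := by
        rintro c A ⟨M, M', hM⟩
        exact ⟨c • M, c • M', by simp [hM, fromBlocks_smul]⟩ }
  neg :=
    { carrier := {A | ∃ M : Matrix (Fin q) (Fin p) Φ, A.1 = fromBlocks 0 0 M 0}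
      add_mem' := by
        rintro A B ⟨M, hM⟩ ⟨N, hN⟩
        exact ⟨M + N, by simp [hM, hN, fromBlocks_add]⟩
      zero_mem' := ⟨0, by simp⟩
      smul_mem' := by
        rintro c A ⟨M, hM⟩
        exact ⟨c • M, by simp [hM, fromBlocks_smul]⟩ }
  existsUnique_add := by
    rintro ⟨A, hA⟩
    have tr : trace A = 0 := hA
    have trace_fromBlocks : ∀ (a : Matrix (Fin p) (Fin p) Φ) b c (d : Matrix (Fin q) (Fin q) Φ),
        trace (fromBlocks a b c d) = trace a + trace d := fun a b c d => by
      simp [trace, Fintype.sum_sum_type]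
    have tr' : trace A.toBlocks₁₁ + trace A.toBlocks₂₂ = 0 := by
      rw [← trace_fromBlocks A.toBlocks₁₁ A.toBlocks₁₂ A.toBlocks₂₁ A.toBlocks₂₂, fromBlocks_toBlocks, tr]
    have mem : ∀ B : Matrix (Fin p ⊕ Fin q) (Fin p ⊕ Fin q) Φ, trace B = 0 →
        B ∈ slBlock Φ p q := fun B hB => hB
    refine ⟨(⟨⟨fromBlocks 0 A.toBlocks₁₂ 0 0, mem _ (by simp [trace_fromBlocks])⟩, _, rfl⟩,
      ⟨⟨fromBlocks A.toBlocks₁₁ 0 0 A.toBlocks₂₂, mem _ (by simp [trace_fromBlocks, tr'])⟩,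
        _, _, rfl⟩,
      ⟨⟨fromBlocks 0 0 A.toBlocks₂₁ 0, mem _ (by simp [trace_fromBlocks])⟩, _, rfl⟩), ?_, ?_⟩
    · apply Subtype.ext
      change fromBlocks 0 A.toBlocks₁₂ 0 0 + fromBlocks A.toBlocks₁₁ 0 0 A.toBlocks₂₂ +
        fromBlocks 0 0 A.toBlocks₂₁ 0 = A
      simp [fromBlocks_add, fromBlocks_toBlocks]
    · rintro ⟨⟨⟨B, hB⟩, M, hM⟩, ⟨⟨C, hC⟩, N, N', hN⟩, ⟨⟨D, hD⟩, K, hK⟩⟩ h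
      have h' : B + C + D = A := congrArg Subtype.val h
      dsimp only at hM hN hK
      subst hM hN hK
      simp only [fromBlocks_add, add_zero, zero_add] at h'
      subst h'
      simp
  lie_pos_pos := by
    rintro A ⟨M, hM⟩ B ⟨N, hN⟩
    apply Subtype.ext
    rw [sl_bracket, hM, hN]
    simp [fromBlocks_multiply]
  lie_neg_neg := by
    rintro A ⟨M, hM⟩ B ⟨N, hN⟩
    apply Subtype.ext
    rw [sl_bracket, hM, hN]
    simp [fromBlocks_multiply]
  lie_pos_neg := by
    rintro A ⟨M, hM⟩ B ⟨N, hN⟩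
    refine ⟨M * N, -(N * M), ?_⟩
    rw [sl_bracket, hM, hN]
    simp [fromBlocks_multiply, sub_eq_add_neg, fromBlocks_neg, fromBlocks_add]
  lie_zero_pos := by
    rintro A ⟨M, M', hM⟩ B ⟨N, hN⟩
    refine ⟨M * N - N * M', ?_⟩
    rw [sl_bracket, hM, hN]
    simp [fromBlocks_multiply, sub_eq_add_neg, fromBlocks_neg, fromBlocks_add]
  lie_zero_neg := by
    rintro A ⟨M, M', hM⟩ B ⟨N, hN⟩
    refine ⟨M' * N - N * M, ?_⟩
    rw [sl_bracket, hM, hN]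
    simp [fromBlocks_multiply, sub_eq_add_neg, fromBlocks_neg, fromBlocks_add]
  lie_zero_zero := by
    rintro A ⟨M, M', hM⟩ B ⟨N, N', hN⟩
    refine ⟨M * N - N * M, M' * N' - N' * M', ?_⟩
    rw [sl_bracket, hM, hN]
    simp [fromBlocks_multiply, sub_eq_add_neg, fromBlocks_neg, fromBlocks_add]

end SL

end ThreeGraded

end

namespace ThreeGraded

attribute [local instance] LieRing.ofAssociativeRing

universe u v w

variable {Φ : Type u} [CommRing Φ] {Xp : Type v} {Xm : Type w}

/-! A graded assignment into `sl(p + q)` sends generators of equal sign to matrices whose product is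
zero, so it extends to an associative homomorphism from `Ass[X⁺, X⁻]` to all block matrices.
Composed with `π` it gives back the evaluation of `f`, because both are Lie homomorphisms agreeing
on generators (`assEval_specialProj`). Hence `π(f) = 0` forces `f` to be an identity of every `sl(p
+ q)`.

Conversely, let `π(f) ≠ 0`. Write it as a combination of alternating words and pick a word `w` of
length `n` with nonzero coefficient. Send each letter `x` to the sum of the matrix units `E(i, i +
1)` over the positions `i` at which `x` occurs in `w`, placed in the off-diagonal block given by the
sign of `x`. A product of such matrices counts walks, and the only word leading from index `0` to
index `n` is `w` itself. So one entry of the evaluation of `f` is exactly the coefficient of `w`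
(`assEval_word_apply`).

Over a field, dividing by the coefficient of a word of maximal length makes `f` essential. -/

theorem lieHom_ext {L : Type*} [LieRing L] [LieAlgebra Φ L]
    {F G : FreeThreeGradedLie Φ Xp Xm →ₗ⁅Φ⁆ L}
    (h : ∀ x, F (LieSubmodule.Quotient.mk (FreeLieAlgebra.of Φ x)) =
      G (LieSubmodule.Quotient.mk (FreeLieAlgebra.of Φ x))) : F = G := by
  let q : FreeLieAlgebra Φ (Xp ⊕ Xm) →ₗ⁅Φ⁆ FreeThreeGradedLie Φ Xp Xm :=
    { (relatorIdeal Φ Xp Xm).toSubmodule.mkQ with map_lie' := rfl }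
  have hq : F.comp q = G.comp q := FreeLieAlgebra.hom_ext h
  ext x
  induction x using Submodule.Quotient.induction_on with | _ x =>
  exact LieHom.congr_fun hq x

/-! ### Coefficients of words -/

/-- A homomorphism on the free associative algebra in terms of the coefficients of words. -/
theorem algHom_apply_eq_sum {A : Type*} [Ring A] [Algebra Φ A]
    (F : FreeAlgebra Φ (Xp ⊕ Xm) →ₐ[Φ] A) (h : FreeAlgebra Φ (Xp ⊕ Xm)) :
    F h = (FreeAlgebra.equivMonoidAlgebraFreeMonoid h).coeff.sum
      fun w c => c • (w.toList.map fun x => F (FreeAlgebra.ι Φ x)).prod := by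
  -- The free algebra is the monoid algebra of the free monoid, so `F` is determined by its values
  -- on letters.
  have key : F = (MonoidAlgebra.lift Φ A (FreeMonoid (Xp ⊕ Xm))
      (FreeMonoid.lift fun x => F (FreeAlgebra.ι Φ x))).comp
      FreeAlgebra.equivMonoidAlgebraFreeMonoid.toAlgHom := by
    ext x
    simp [FreeAlgebra.equivMonoidAlgebraFreeMonoid]
  conv_lhs => rw [key]
  simp [MonoidAlgebra.lift_apply, FreeMonoid.lift_apply]

theorem eq_zero_of_wordCoeff_eq_zero {h : FreeAlgebra Φ (Xp ⊕ Xm)}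
    (hh : ∀ w, wordCoeff h w = 0) : h = 0 := by
  apply FreeAlgebra.equivMonoidAlgebraFreeMonoid.injective
  rw [map_zero]
  apply MonoidAlgebra.coeff_injective
  ext w
  exact hh w.toList

theorem wordCoeff_smul (c : Φ) (h : FreeAlgebra Φ (Xp ⊕ Xm)) (w : List (Xp ⊕ Xm)) :
    wordCoeff (c • h) w = c * wordCoeff h w := by
  simp [wordCoeff]

/-- The words with alternating signs. -/
def IsAlternating (w : List (Xp ⊕ Xm)) : Prop := w.IsChain fun x y => sgn x ≠ sgn y

theorem prod_assGen_eq_zero : ∀ {w : List (Xp ⊕ Xm)}, ¬ IsAlternating w →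
    (w.map (assGen Φ)).prod = 0
  | [], h => (h List.IsChain.nil).elim
  | [x], h => (h (List.IsChain.singleton x)).elim
  | x :: y :: l, h => by
    by_cases hxy : sgn x = sgn y
    · rw [List.map_cons, List.map_cons, List.prod_cons, List.prod_cons, ← mul_assoc,
        assGen_mul_assGen Φ hxy, zero_mul]
    · have h' : ¬ IsAlternating (y :: l) := fun hl => h (List.isChain_cons_cons.2 ⟨hxy, hl⟩)
      rw [List.map_cons, List.prod_cons, prod_assGen_eq_zero h', mul_zero]

/-- Non-alternating words vanish in `Ass[X⁺, X⁻]`, so they can be deleted from any representative.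
Only this spanning property is needed here, not the independence of the alternating words. -/
theorem exists_alternating_representative (g : FreeThreeGradedAss Φ Xp Xm) :
    ∃ h : FreeAlgebra Φ (Xp ⊕ Xm), assMk Φ Xp Xm h = g ∧
      ∀ w, wordCoeff h w ≠ 0 → IsAlternating w := by
  classical
  obtain ⟨h, rfl⟩ := RingQuot.mkAlgHom_surjective Φ (AssRel Φ Xp Xm) g
  let e := FreeAlgebra.equivMonoidAlgebraFreeMonoid (R := Φ) (X := Xp ⊕ Xm)
  refine ⟨e.symm (.ofCoeff ((e h).coeff.filter fun w => IsAlternating w.toList)), ?_, ?_⟩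
  · change assMk Φ Xp Xm _ = assMk Φ Xp Xm h
    rw [algHom_apply_eq_sum, algHom_apply_eq_sum _ h]
    change (e (e.symm _)).coeff.sum _ = _
    rw [e.apply_symm_apply, MonoidAlgebra.coeff_ofCoeff, Finsupp.sum, Finsupp.sum,
      Finsupp.support_filter]
    -- The two sums agree on the alternating words; the remaining terms of the larger sum are zero.
    refine (Finset.sum_congr rfl fun w hw => ?_).trans
      (Finset.sum_subset (Finset.filter_subset _ _) fun w hw hw' => ?_)
    · exact congrArg (· • _)
        (Finsupp.filter_apply_pos (fun w : FreeMonoid _ => IsAlternating w.toList) _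
          (Finset.mem_filter.1 hw).2)
    · have : ¬ IsAlternating w.toList := fun ha => hw' (Finset.mem_filter.2 ⟨hw, ha⟩)
      have h0 := prod_assGen_eq_zero (Φ := Φ) this
      exact (congrArg _ h0).trans (smul_zero _)
  · intro w hw
    by_contra ha
    apply hw
    change (e (e.symm _)).coeff _ = 0
    rw [e.apply_symm_apply, MonoidAlgebra.coeff_ofCoeff]
    exact Finsupp.filter_apply_neg _ _ ha

/-- A nonzero element of `Ass[X⁺, X⁻]` has an alternating representative with a word of
maximal length in its support. -/
theorem exists_representative_with_maximal_word {g : FreeThreeGradedAss Φ Xp Xm} (hg : g ≠ 0) :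
    ∃ h : FreeAlgebra Φ (Xp ⊕ Xm), assMk Φ Xp Xm h = g ∧
      (∀ w, wordCoeff h w ≠ 0 → IsAlternating w) ∧
      ∃ w, wordCoeff h w ≠ 0 ∧ ∀ w', wordCoeff h w' ≠ 0 → w'.length ≤ w.length := by
  obtain ⟨h, hh, halt⟩ := exists_alternating_representative g
  have hne : (FreeAlgebra.equivMonoidAlgebraFreeMonoid h).coeff.support.Nonempty := by
    by_contra hem
    rw [Finset.not_nonempty_iff_eq_empty, Finsupp.support_eq_empty] at hem
    apply hg
    rw [← hh, eq_zero_of_wordCoeff_eq_zero (h := h) fun w => by rw [wordCoeff, hem]; rfl, map_zero]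
  obtain ⟨w, hw, hmax⟩ := Finset.exists_max_image _ (fun w => w.toList.length) hne
  refine ⟨h, hh, halt, w.toList, Finsupp.mem_support_iff.1 hw, fun w' hw' => ?_⟩
  exact hmax (FreeMonoid.ofList w') (Finsupp.mem_support_iff.2 hw')

/-! ### Evaluation in matrices -/

section Evaluation

variable {p q : ℕ} (a : Xp → (slGrading Φ p q).pos) (b : Xm → (slGrading Φ p q).neg)

/-- The matrix assigned to a generator. -/
noncomputable def generatorMatrix (x : Xp ⊕ Xm) : Matrix (Fin p ⊕ Fin q) (Fin p ⊕ Fin q) Φ :=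
  ((slGrading Φ p q).assignment a b x).1

theorem generatorMatrix_mul {x y : Xp ⊕ Xm} (hxy : sgn x = sgn y) :
    generatorMatrix a b x * generatorMatrix a b y = 0 := by
  rcases x with x | x <;> rcases y with y | y
  · obtain ⟨M, hM⟩ := (a x).2
    obtain ⟨N, hN⟩ := (a y).2
    change (a x).1.1 * (a y).1.1 = 0
    rw [hM, hN]
    simp [Matrix.fromBlocks_multiply]
  · simp [sgn] at hxy
  · simp [sgn] at hxy
  · obtain ⟨M, hM⟩ := (b x).2
    obtain ⟨N, hN⟩ := (b y).2
    change (b x).1.1 * (b y).1.1 = 0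
    rw [hM, hN]
    simp [Matrix.fromBlocks_multiply]

/-- The associative homomorphism `Ass[X⁺, X⁻] → M(p + q)` extending an assignment. -/
noncomputable def assEval : FreeThreeGradedAss Φ Xp Xm →ₐ[Φ] Matrix (Fin p ⊕ Fin q) (Fin p ⊕ Fin q) Φ :=
  RingQuot.liftAlgHom Φ ⟨FreeAlgebra.lift Φ (generatorMatrix a b), by
    rintro _ _ ⟨hxy⟩
    simp [generatorMatrix_mul a b hxy]⟩

theorem assEval_assMk (h : FreeAlgebra Φ (Xp ⊕ Xm)) :
    assEval a b (assMk Φ Xp Xm h) = FreeAlgebra.lift Φ (generatorMatrix a b) h :=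
  RingQuot.liftAlgHom_mkAlgHom_apply ..

/-- Evaluation in `sl(p + q)` factors through `π`: two Lie homomorphisms on `𝓛(X⁺, X⁻)` are equal
once they agree on generators. -/
theorem assEval_specialProj (f : FreeThreeGradedLie Φ Xp Xm) :
    assEval a b (specialProj Φ f : FreeThreeGradedAss Φ Xp Xm) =
      ((slGrading Φ p q).eval a b f).1 := by
  have key : ((assEval a b).toLieHom.comp (SpecialLie Φ Xp Xm).incl).comp (specialProj Φ) =
      (slBlock Φ p q).incl.comp ((slGrading Φ p q).eval a b) := by
    apply lieHom_ext
    intro x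
    have h1 : specialProj Φ (LieSubmodule.Quotient.mk (FreeLieAlgebra.of Φ x)) =
        specialGen Φ x := by
      rw [specialProj, liftOfRelators_mk, FreeLieAlgebra.lift_of_apply]
    have h2 : (slGrading Φ p q).eval a b (LieSubmodule.Quotient.mk (FreeLieAlgebra.of Φ x)) =
        (slGrading Φ p q).assignment a b x := by
      rw [ThreeGrading.eval, liftOfRelators_mk, FreeLieAlgebra.lift_of_apply]
    rw [LieHom.comp_apply, LieHom.comp_apply, LieHom.comp_apply, h1, h2]
    change assEval a b (assMk Φ Xp Xm (FreeAlgebra.ι Φ x)) = generatorMatrix a b x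
    rw [assEval_assMk, FreeAlgebra.lift_ι_apply]
  exact LieHom.congr_fun key f

theorem specialProj_ne_zero_of_not_isIdentity {f : FreeThreeGradedLie Φ Xp Xm}
    (hf : ¬ (slGrading Φ p q).IsIdentity f) : specialProj Φ f ≠ 0 := by
  intro h0
  apply hf
  intro a b
  apply Subtype.ext
  rw [← assEval_specialProj a b f, h0]
  exact map_zero (assEval a b)

end Evaluation

/-! ### Matrices detecting a word -/

section WordMatrix

open Classical in
/-- The matrix with entry `1` in position `(i, i + 1)` if the `i`-th letter of `w` is `x`, and
zeros elsewhere. -/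
noncomputable def stepMatrix (w : List (Xp ⊕ Xm)) (x : Xp ⊕ Xm) :
    Matrix (Fin (w.length + 1)) (Fin (w.length + 1)) Φ :=
  -- Addition in `Fin` wraps around at the last index, but there `w[i]?` is `none`, so the last row
  -- is zero.
  Matrix.of fun i j => if w[(i : ℕ)]? = some x ∧ j = i + 1 then 1 else 0

theorem fromBlocks_mem_slBlock {p q : ℕ} (M : Matrix (Fin p) (Fin q) Φ)
    (N : Matrix (Fin q) (Fin p) Φ) : Matrix.fromBlocks 0 M N 0 ∈ slBlock Φ p q := by
  change Matrix.trace (Matrix.fromBlocks 0 M N 0) = 0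
  simp [Matrix.trace, Fintype.sum_sum_type]

/-- The assignment in `sl(n + 1, n + 1)₁` attached to a word of length `n`. -/
noncomputable def wordPos (w : List (Xp ⊕ Xm)) (x : Xp) :
    (slGrading Φ (w.length + 1) (w.length + 1)).pos :=
  ⟨⟨Matrix.fromBlocks 0 (stepMatrix w (Sum.inl x)) 0 0, fromBlocks_mem_slBlock _ _⟩, _, rfl⟩

/-- The assignment in `sl(n + 1, n + 1)₋₁` attached to a word of length `n`. -/
noncomputable def wordNeg (w : List (Xp ⊕ Xm)) (x : Xm) :
    (slGrading Φ (w.length + 1) (w.length + 1)).neg :=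
  ⟨⟨Matrix.fromBlocks 0 0 (stepMatrix w (Sum.inr x)) 0, fromBlocks_mem_slBlock _ _⟩, _, rfl⟩

/-- The index `i` in the first block (`true`) or in the second block (`false`). -/
def vertex {n : ℕ} (s : Bool) (i : Fin n) : Fin n ⊕ Fin n := bif s then .inl i else .inr i

/-- The block of the row index of the matrices assigned to the first letter of a word, and
`t` for the empty word. -/
def startBlock (t : Bool) : List (Xp ⊕ Xm) → Bool
  | [] => t
  | x :: _ => x.isLeft

/-- A word describes a walk between the blocks that ends in the block `t`. -/
def EndsIn (t : Bool) : List (Xp ⊕ Xm) → Prop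
  | [] => True
  | x :: l => (!x.isLeft) = startBlock t l ∧ EndsIn t l

/-- Each letter leads from one block to the other, so consecutive steps fit together exactly when
the signs alternate. -/
theorem IsAlternating.exists_endsIn : ∀ {w : List (Xp ⊕ Xm)}, IsAlternating w → ∃ t, EndsIn t w
  | [], _ => ⟨true, trivial⟩
  | [x], _ => ⟨!x.isLeft, rfl, trivial⟩
  | x :: y :: l, h => by
    obtain ⟨hxy, hl⟩ := List.isChain_cons_cons.1 h
    obtain ⟨t, ht⟩ := IsAlternating.exists_endsIn (w := y :: l) hl
    refine ⟨t, ?_, ht⟩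
    rcases x with x | x <;> rcases y with y | y <;> simp [sgn, startBlock] at hxy ⊢

open Classical in
-- Each row of a generator's matrix has at most one nonzero entry, so multiplying on the left by it
-- performs one step of the walk.
theorem generatorMatrix_word_mul (w : List (Xp ⊕ Xm)) (x : Xp ⊕ Xm) (s : Bool)
    (i : Fin (w.length + 1)) (e)
    (M : Matrix (Fin (w.length + 1) ⊕ Fin (w.length + 1)) (Fin (w.length + 1) ⊕ Fin (w.length + 1))
      Φ) :
    (generatorMatrix (Φ := Φ) (wordPos w) (wordNeg w) x * M) (vertex s i) e =
      if s = x.isLeft ∧ w[(i : ℕ)]? = some x then M (vertex (!x.isLeft) (i + 1)) e else 0 := by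
  rcases x with x | x
  · change (Matrix.fromBlocks (0 : Matrix _ _ Φ) (stepMatrix w (Sum.inl x)) 0 0 * M :
      Matrix (Fin _ ⊕ Fin _) _ Φ) _ _ = _
    cases s <;> simp [vertex, Matrix.mul_apply, Fintype.sum_sum_type, stepMatrix, ite_and]
  · change (Matrix.fromBlocks (0 : Matrix _ _ Φ) 0 (stepMatrix w (Sum.inr x)) 0 * M :
      Matrix (Fin _ ⊕ Fin _) _ Φ) _ _ = _
    cases s <;> simp [vertex, Matrix.mul_apply, Fintype.sum_sum_type, stepMatrix, ite_and]

open Classical in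
-- Starting from position `i`, each step must read the next letter of `w`, so reaching the last
-- index forces `v` to spell the remaining suffix. The suffix varies in the induction on `v`.
theorem prod_generatorMatrix_word (w : List (Xp ⊕ Xm)) (t : Bool) (v : List (Xp ⊕ Xm)) :
    ∀ (l : List (Xp ⊕ Xm)) (i : Fin (w.length + 1)), w.drop i = l → EndsIn t l →
      (v.map (generatorMatrix (Φ := Φ) (wordPos w) (wordNeg w))).prod
        (vertex (startBlock t l) i) (vertex t (Fin.last w.length)) = if v = l then 1 else 0 := by
  induction v with
  | nil =>
    intro l i hl _
    have hlen : l.length = w.length - i := by rw [← hl, List.length_drop]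
    -- For empty `v` the product is the identity matrix, and the two vertices coincide only if no
    -- letters of `w` remain.
    rcases l with _ | ⟨y, l⟩
    · have : i = Fin.last w.length := by
        ext
        simp only [List.length_nil] at hlen
        simp only [Fin.val_last]
        omega
      simp [this, startBlock]
    · have : i ≠ Fin.last w.length := by
        rintro rfl
        simp at hlen
      rw [List.map_nil, List.prod_nil, Matrix.one_apply_ne, if_neg (by simp)]
      intro h
      apply this
      simp only [vertex] at h
      generalize startBlock t (y :: l) = s at h
      cases s <;> cases t <;> simp_all
  | cons x v ih =>
    intro l i hl hend
    rw [List.map_cons, List.prod_cons, generatorMatrix_word_mul]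
    rcases l with _ | ⟨y, l⟩
    · have : w[(i : ℕ)]? = none := by
        rw [List.getElem?_eq_none_iff]
        exact List.drop_eq_nil_iff.1 hl
      simp [this]
    · have hy : w[(i : ℕ)]? = some y := by
        rw [← List.head?_drop, hl, List.head?_cons]
      have hi : (i : ℕ) < w.length := (List.getElem?_eq_some_iff.1 hy).1
      by_cases hxy : y = x
      · subst hxy
        -- No wraparound occurs, since a letter remains to be read at `i`.
        have hval : ((i + 1 : Fin (w.length + 1)) : ℕ) = i + 1 :=
          Fin.val_add_one_of_lt (by rw [Fin.lt_def]; exact hi)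
        have hdrop : w.drop ((i + 1 : Fin (w.length + 1)) : ℕ) = l := by
          rw [hval, ← List.drop_drop, hl, List.drop_one, List.tail_cons]
        rw [if_pos ⟨rfl, hy⟩, hend.1, ih l _ hdrop hend.2]
        simp
      · rw [if_neg (by simp [hy, hxy]), if_neg (by simp [Ne.symm hxy])]

/-- Every coefficient of an alternating word is an entry of a matrix evaluation. -/
theorem assEval_word_apply (w : List (Xp ⊕ Xm)) {t : Bool} (ht : EndsIn t w)
    (h : FreeAlgebra Φ (Xp ⊕ Xm)) :
    assEval (wordPos w) (wordNeg w) (assMk Φ Xp Xm h) (vertex (startBlock t w) 0)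
      (vertex t (Fin.last w.length)) = wordCoeff h w := by
  classical
  rw [assEval_assMk, algHom_apply_eq_sum, Finsupp.sum, Matrix.sum_apply]
  simp only [FreeAlgebra.lift_ι_apply, Matrix.smul_apply]
  refine (Finset.sum_congr rfl fun v _ => congrArg _
    (prod_generatorMatrix_word w t v.toList w 0 (by simp) ht)).trans ?_
  have heq : ∀ v : FreeMonoid (Xp ⊕ Xm), v.toList = w ↔ v = FreeMonoid.ofList w := fun _ => Iff.rfl
  simp only [heq, smul_eq_mul, mul_ite, mul_one, mul_zero, Finset.sum_ite_eq']
  split_ifs with hw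
  · rfl
  · exact (Finsupp.notMem_support_iff.1 hw).symm

end WordMatrix

/-! ### The two equivalences -/

theorem exists_not_isIdentity {f : FreeThreeGradedLie Φ Xp Xm} (hf : specialProj Φ f ≠ 0) :
    ∃ p q : ℕ, ¬ (slGrading Φ p q).IsIdentity f := by
  have hne : (specialProj Φ f : FreeThreeGradedAss Φ Xp Xm) ≠ 0 :=
    fun h0 => hf (Subtype.ext h0)
  obtain ⟨h, hh, halt, w, hw, -⟩ := exists_representative_with_maximal_word hne
  obtain ⟨t, ht⟩ := (halt w hw).exists_endsIn
  -- A walk with `n` steps visits `n + 1` indices, and both blocks carry a copy of each.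
  refine ⟨w.length + 1, w.length + 1, fun hid => hw ?_⟩
  rw [← assEval_word_apply w ht h, hh, assEval_specialProj, hid (wordPos w) (wordNeg w)]
  rfl

theorem exists_smul_isEssential (hΦ : IsField Φ) {f : FreeThreeGradedLie Φ Xp Xm}
    (hf : specialProj Φ f ≠ 0) : ∃ c : Φ, c ≠ 0 ∧ IsEssential (c • f) := by
  have hne : (specialProj Φ f : FreeThreeGradedAss Φ Xp Xm) ≠ 0 :=
    fun h0 => hf (Subtype.ext h0)
  obtain ⟨h, hh, halt, w, hw, hmax⟩ := exists_representative_with_maximal_word hne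
  -- The scalar is the inverse of the coefficient of a longest word. Scaling adds no new words, so
  -- alternation and maximality persist.
  obtain ⟨c, hc⟩ := hΦ.mul_inv_cancel hw
  have : Nontrivial Φ := hΦ.nontrivial
  have hcne : c ≠ 0 := by
    rintro rfl
    simp at hc
  have hsupp : ∀ v, wordCoeff (c • h) v ≠ 0 → wordCoeff h v ≠ 0 := fun v hv h0 =>
    hv (by rw [wordCoeff_smul, h0, mul_zero])
  have hone : wordCoeff (c • h) w = 1 := by rw [wordCoeff_smul, mul_comm, hc]
  refine ⟨c, hcne, fun h0 => hf ?_, c • h, ?_, fun v hv => halt v (hsupp v hv), w, ?_, hone,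
    fun v hv => hmax v (hsupp v hv)⟩
  · rw [map_smul] at h0
    rw [← one_smul Φ (specialProj Φ f), ← hc, mul_smul, h0, smul_zero]
  · rw [map_smul, map_smul, hh]
    rfl
  · rw [hone]
    exact one_ne_zero

theorem specialProj_ne_zero_iff (f : FreeThreeGradedLie Φ Xp Xm) :
    specialProj Φ f ≠ 0 ↔ ∃ p q : ℕ, ¬ (slGrading Φ p q).IsIdentity f :=
  ⟨exists_not_isIdentity, fun ⟨_, _, h⟩ => specialProj_ne_zero_of_not_isIdentity h⟩

end ThreeGraded

theorem mainTheorem4 {Φ : Type*} [CommRing Φ] (h2 : IsUnit (2 : Φ)) {Xp Xm : Type*}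
    (f : ThreeGraded.FreeThreeGradedLie Φ Xp Xm) :
    (ThreeGraded.specialProj Φ f ≠ 0 ↔
      ∃ p q : ℕ, ¬ (ThreeGraded.slGrading Φ p q).IsIdentity f) ∧
    (IsField Φ →
      ((∃ c : Φ, c ≠ 0 ∧ ThreeGraded.IsEssential (c • f)) ↔
        ∃ p q : ℕ, ¬ (ThreeGraded.slGrading Φ p q).IsIdentity f)) := by
  refine ⟨ThreeGraded.specialProj_ne_zero_iff f, fun hΦ => ?_⟩
  rw [← ThreeGraded.specialProj_ne_zero_iff f]
  refine ⟨?_, ThreeGraded.exists_smul_isEssential hΦ⟩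
  rintro ⟨c, -, hne, -⟩ h0
  exact hne (by rw [map_smul, h0, smul_zero])
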